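/- Let $\varrho$ be a three-qubit state. Call $\varrho$ a CTN state (triangle network with local channels) if there are finite-dimensional systems $A_1,A_2,B_1,B_2,C_1,C_2$, density matrices $\varrho_b$ on $C_2A_1$, $\varrho_c$ on $A_2B_1$ and $\varrho_a$ on $B_2C_1$, and quantum channels (completely positive trace-preserving linear maps) $\mathcal E_A,\mathcal E_B,\mathcal E_C$ from $A=A_1A_2$, $B=B_1B_2$, $C=C_1C_2$, respectively, to a qubit, such that $$\varrho=(\mathcal E_A\otimes\mathcal E_B\otimes\mathcal E_C)(\varrho_b\otimes\varrho_c\otimes\varrho_a),$$ where the tensor factors are reordered according to the parties $A,B,C$. Call $\varrho$ an LOSR triangle-network state (local operations and shared randomness) if $\varrho=\sum_\lambda p_\lambda\varrho_\lambda$ for a finite or countable probability distribution $(p_\lambda)$ and CTN states $\varrho_\lambda$ (whose sources, source dimensions and channels may depend on $\lambda$). Let $|GHZ\rangle=\frac1{\sqrt2}(|000\rangle+|111\rangle)$. Then every CTN state, and more generally every LOSR triangle-network state, $\varrho$ satisfies $$\langle GHZ|\varrho|GHZ\rangle\le 3-\sqrt5\ (\approx 0.76),$$ and this upper bound can be improved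 to $$\langle GHZ|\varrho|GHZ\rangle\le \frac1{\sqrt2}\ (\approx 0.71).$$ -/

import Mathlib

open scoped Matrix Kronecker ComplexOrder

noncomputable section

/-- A quantum state (density matrix): positive semidefinite with trace one. -/
def IsDensityMatrix {n : Type*} [Fintype n] (ρ : Matrix n n ℂ) : Prop :=
  ρ.PosSemidef ∧ ρ.trace = 1

/-- The ampliation `id_κ ⊗ E` of a linear map `E` between matrix algebras, which applies `E` to
each block of a matrix whose blocks are labelled by `κ × κ`. -/
def ampliation (κ : Type*) {n m : Type*} (E : Matrix n n ℂ →ₗ[ℂ] Matrix m m ℂ)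
    (M : Matrix (κ × n) (κ × n) ℂ) : Matrix (κ × m) (κ × m) ℂ :=
  Matrix.of fun x y => E (Matrix.of fun a b => M (x.1, a) (y.1, b)) x.2 y.2

/-- Complete positivity: `id_k ⊗ E` preserves positive semidefiniteness for every `k`. -/
def IsCompletelyPositive {n m : Type*} (E : Matrix n n ℂ →ₗ[ℂ] Matrix m m ℂ) : Prop :=
  ∀ (k : ℕ) (M : Matrix (Fin k × n) (Fin k × n) ℂ),
    M.PosSemidef → (ampliation (Fin k) E M).PosSemidef

/-- A quantum channel: a completely positive and trace preserving linear map. -/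
def IsQuantumChannel {n m : Type*} [Fintype n] [Fintype m]
    (E : Matrix n n ℂ →ₗ[ℂ] Matrix m m ℂ) : Prop :=
  IsCompletelyPositive E ∧ ∀ X : Matrix n n ℂ, (E X).trace = X.trace

/-- The matrix `(E_A ⊗ E_B ⊗ E_C)(ρ)`, obtained by expanding `ρ` in the product matrix units
`e_{aa'} ⊗ e_{bb'} ⊗ e_{cc'}` and applying each map to its own factor. -/
def applyLocal {a b c α β γ : Type*} [Fintype a] [Fintype b] [Fintype c]
    [DecidableEq a] [DecidableEq b] [DecidableEq c]
    (EA : Matrix a a ℂ →ₗ[ℂ] Matrix α α ℂ) (EB : Matrix b b ℂ →ₗ[ℂ] Matrix β β ℂ)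
    (EC : Matrix c c ℂ →ₗ[ℂ] Matrix γ γ ℂ) (ρ : Matrix (a × b × c) (a × b × c) ℂ) :
    Matrix (α × β × γ) (α × β × γ) ℂ :=
  ∑ x : a × b × c, ∑ y : a × b × c, ρ x y •
    (EA (Matrix.single x.1 y.1 1) ⊗ₖ
      (EB (Matrix.single x.2.1 y.2.1 1) ⊗ₖ EC (Matrix.single x.2.2 y.2.2 1)))

/-- The basic triangle network state `ρ_b ⊗ ρ_c ⊗ ρ_a`, where the source `ρ_b` feeds `C₂, A₁`, the
source `ρ_c` feeds `A₂, B₁` and the source `ρ_a` feeds `B₂, C₁`, with the six subsystems rearranged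
according to the parties `A = A₁A₂`, `B = B₁B₂`, `C = C₁C₂`. -/
def btnState {A₁ A₂ B₁ B₂ C₁ C₂ : Type*}
    (ρb : Matrix (C₂ × A₁) (C₂ × A₁) ℂ) (ρc : Matrix (A₂ × B₁) (A₂ × B₁) ℂ)
    (ρa : Matrix (B₂ × C₁) (B₂ × C₁) ℂ) :
    Matrix ((A₁ × A₂) × (B₁ × B₂) × (C₁ × C₂)) ((A₁ × A₂) × (B₁ × B₂) × (C₁ × C₂)) ℂ :=
  let regroup : (A₁ × A₂) × (B₁ × B₂) × (C₁ × C₂) → (C₂ × A₁) × (A₂ × B₁) × (B₂ × C₁) :=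
    fun x => ((x.2.2.2, x.1.1), (x.1.2, x.2.1.1), (x.2.1.2, x.2.2.1))
  (ρb ⊗ₖ (ρc ⊗ₖ ρa)).submatrix regroup regroup

/-- States of the triangle network with local channels. The source states live on arbitrary
finite-dimensional systems. -/
def IsCTNState {α β γ : Type*} [Fintype α] [Fintype β] [Fintype γ]
    (ρ : Matrix (α × β × γ) (α × β × γ) ℂ) : Prop :=
  ∃ (a₁ a₂ b₁ b₂ c₁ c₂ : ℕ)
    (ρb : Matrix (Fin c₂ × Fin a₁) (Fin c₂ × Fin a₁) ℂ)
    (ρc : Matrix (Fin a₂ × Fin b₁) (Fin a₂ × Fin b₁) ℂ)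
    (ρa : Matrix (Fin b₂ × Fin c₁) (Fin b₂ × Fin c₁) ℂ)
    (EA : Matrix (Fin a₁ × Fin a₂) (Fin a₁ × Fin a₂) ℂ →ₗ[ℂ] Matrix α α ℂ)
    (EB : Matrix (Fin b₁ × Fin b₂) (Fin b₁ × Fin b₂) ℂ →ₗ[ℂ] Matrix β β ℂ)
    (EC : Matrix (Fin c₁ × Fin c₂) (Fin c₁ × Fin c₂) ℂ →ₗ[ℂ] Matrix γ γ ℂ),
    IsDensityMatrix ρb ∧ IsDensityMatrix ρc ∧ IsDensityMatrix ρa ∧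
    IsQuantumChannel EA ∧ IsQuantumChannel EB ∧ IsQuantumChannel EC ∧
    ρ = applyLocal EA EB EC (btnState ρb ρc ρa)

/-- States of the triangle network with local operations and shared randomness: (finite or
countable) mixtures `∑_l p_l ρ_l` of states of the triangle network with local channels. The sources,
their dimensions and the channels may all depend on the value `l` of the random variable. -/
def IsLOSRState {α β γ : Type*} [Fintype α] [Fintype β] [Fintype γ]
    (ρ : Matrix (α × β × γ) (α × β × γ) ℂ) : Prop :=
  ∃ (L : Type) (p : L → ℝ) (σ : L → Matrix (α × β × γ) (α × β × γ) ℂ),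
    (∀ l, 0 ≤ p l) ∧ HasSum p 1 ∧ (∀ l, IsCTNState (σ l)) ∧ HasSum (fun l => p l • σ l) ρ

/-- The three-qubit GHZ vector `(|000⟩ + |111⟩) / √2`. -/
def ghz : Fin 2 × Fin 2 × Fin 2 → ℂ :=
  ((1 / √2 : ℝ) : ℂ) • (Pi.single (0, 0, 0) 1 + Pi.single (1, 1, 1) 1)

/-- The fidelity `⟨ψ|ρ|ψ⟩` of a state `ρ` with a pure state `ψ` (for a Hermitian matrix `ρ` this
number is real). -/
def pureFidelity {n : Type*} [Fintype n] (ψ : n → ℂ) (ρ : Matrix n n ℂ) : ℝ :=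
  (star ψ ⬝ᵥ (ρ *ᵥ ψ)).re

end

/-!
The GHZ fidelity of a state `ρ` is `(P + Q) / 2 + t`, where `P` and `Q` are the probabilities of
finding `000` and `111` in the computational basis and `t` is the real part of an off-diagonal
entry, so `t ^ 2 ≤ P * Q` by positivity. A large fidelity thus requires that the outcomes of the
three parties nearly always agree while both common values have substantial weight. The triangle
network forbids this, by an inflation argument.

Replace the source shared by `A` and `C` by the product of its two marginals. The result is again a
state of the triangle network, so its outcome probabilities are nonnegative
(`posSemidef_applyLocal`). The joint distributions of `A, B` and of `B, C` are unchanged, while the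
outcomes of `A` and `C` become independent with unchanged marginals (`exists_cut_inflation`).
Whenever `A` and `C` disagree, one of them disagrees with `B`; hence, with `a` and `c` the
probabilities that `A` and `C` output one in the original network,
`a * (1 - c) + (1 - a) * c ≤ P(A ≠ B) + P(B ≠ C)` (`cut_inflation_inequality`).

Adding the three inequalities obtained by cutting each of the sources gives
`6 * x * (1 - x) ≤ 4 * r`, where `x` is the mean of the three probabilities of the outcome one and
`r = 1 - P - Q`. Since `x ≥ Q + r / 3` and `1 - x ≥ P + r / 3`, this yields
`P * Q ≤ r / 3 + 2 * r ^ 2 / 9`, which together with `t ^ 2 ≤ P * Q` forces the fidelity below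
`7 / 10` (`half_add_lt_of_sum_disagreement_le`), and `7 / 10` is smaller than both `1 / √2` and
`3 - √5`. The fidelity is linear and continuous in the state, so the bound extends to mixtures
(`IsLOSRState.pureFidelity_le`).
-/

/-! ### Complete positivity and local maps -/

/-- A linear map on matrices is determined by its values on the matrix units. -/
theorem linearMap_apply_eq_sum_single {n m : Type*} [Fintype n] [DecidableEq n]
    (E : Matrix n n ℂ →ₗ[ℂ] Matrix m m ℂ) (X : Matrix n n ℂ) (i j : m) :
    E X i j = ∑ x, ∑ y, X x y * E (Matrix.single x y 1) i j := by
  conv_lhs => rw [Matrix.matrix_eq_sum_single X]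
  simp only [map_sum, Matrix.sum_apply]
  refine Finset.sum_congr rfl fun x _ => Finset.sum_congr rfl fun y _ => ?_
  have h : Matrix.single x y (X x y) = X x y • Matrix.single x y (1 : ℂ) := by
    simp [Matrix.smul_single]
  rw [h, map_smul, Matrix.smul_apply, smul_eq_mul]

/-- The Choi matrix `∑ e_{xy} ⊗ E(e_{xy})` of a linear map `E` between matrix algebras. -/
def choiMatrix {n m : Type*} [DecidableEq n] (E : Matrix n n ℂ →ₗ[ℂ] Matrix m m ℂ) :
    Matrix (n × m) (n × m) ℂ :=
  Matrix.of fun x y => E (Matrix.single x.1 y.1 1) x.2 y.2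

/-- The Choi matrix is the image of the unnormalized maximally entangled projector under
`id ⊗ E`. -/
theorem IsCompletelyPositive.posSemidef_choiMatrix {n m : Type*} [Fintype n] [DecidableEq n]
    {E : Matrix n n ℂ →ₗ[ℂ] Matrix m m ℂ} (hE : IsCompletelyPositive E) :
    (choiMatrix E).PosSemidef := by
  let e := Fintype.equivFin n
  let v : Fin (Fintype.card n) × n → ℂ := fun s => if e.symm s.1 = s.2 then 1 else 0
  have h := (hE _ _ (Matrix.posSemidef_vecMulVec_self_star v)).submatrix
    fun x : n × m => (e x.1, x.2)
  convert h using 1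
  ext x y
  simp only [choiMatrix, ampliation, Matrix.of_apply, Matrix.submatrix_apply]
  refine congrArg (fun M => E M x.2 y.2) ?_
  ext a b
  simp only [Matrix.of_apply, Matrix.single_apply, Matrix.vecMulVec_apply, v,
    Equiv.symm_apply_apply, Pi.star_apply]
  split_ifs <;> simp_all

/-- Compressing a positive semidefinite matrix on `X ⊗ I` by the all-ones vector of `X` leaves a
positive semidefinite matrix on `I`. -/
theorem Matrix.PosSemidef.sum_blocks {X I : Type*} [Fintype X] [Fintype I]
    {S : Matrix (X × I) (X × I) ℂ} (hS : S.PosSemidef) :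
    (Matrix.of fun i j => ∑ x, ∑ y, S (x, i) (y, j)).PosSemidef := by
  classical
  let B : Matrix I (X × I) ℂ := Matrix.of fun i s => if i = s.2 then 1 else 0
  convert hS.mul_mul_conjTranspose_same B using 1
  ext i j
  simp only [Matrix.mul_apply, B, Matrix.of_apply, Matrix.conjTranspose_apply,
    Fintype.sum_prod_type, apply_ite star, star_one, star_zero, ite_mul, one_mul, zero_mul,
    mul_ite, mul_one, mul_zero, Finset.sum_ite_eq, Finset.mem_univ, if_true]
  exact Finset.sum_comm

section

variable {a b c α β γ : Type*} [Fintype a] [Fintype b] [Fintype c]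
  [DecidableEq a] [DecidableEq b] [DecidableEq c]

theorem applyLocal_apply (EA : Matrix a a ℂ →ₗ[ℂ] Matrix α α ℂ)
    (EB : Matrix b b ℂ →ₗ[ℂ] Matrix β β ℂ) (EC : Matrix c c ℂ →ₗ[ℂ] Matrix γ γ ℂ)
    (ρ : Matrix (a × b × c) (a × b × c) ℂ) (s t : α × β × γ) :
    applyLocal EA EB EC ρ s t = ∑ x, ∑ y, ρ x y * (EA (Matrix.single x.1 y.1 1) s.1 t.1 *
      (EB (Matrix.single x.2.1 y.2.1 1) s.2.1 t.2.1 *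
        EC (Matrix.single x.2.2 y.2.2 1) s.2.2 t.2.2)) := by
  simp [applyLocal, Matrix.sum_apply, Matrix.kroneckerMap_apply]

/-- Completely positive local maps preserve positivity: up to a compression, the output is the
Schur product of the input with the three Choi matrices. -/
theorem posSemidef_applyLocal [Fintype α] [Fintype β] [Fintype γ]
    {EA : Matrix a a ℂ →ₗ[ℂ] Matrix α α ℂ} {EB : Matrix b b ℂ →ₗ[ℂ] Matrix β β ℂ}
    {EC : Matrix c c ℂ →ₗ[ℂ] Matrix γ γ ℂ} (hA : IsCompletelyPositive EA)
    (hB : IsCompletelyPositive EB) (hC : IsCompletelyPositive EC)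
    {ρ : Matrix (a × b × c) (a × b × c) ℂ} (hρ : ρ.PosSemidef) :
    (applyLocal EA EB EC ρ).PosSemidef := by
  have hJ := (hA.posSemidef_choiMatrix.kronecker
    (hB.posSemidef_choiMatrix.kronecker hC.posSemidef_choiMatrix)).submatrix
      fun s : (a × b × c) × (α × β × γ) =>
        ((s.1.1, s.2.1), (s.1.2.1, s.2.2.1), (s.1.2.2, s.2.2.2))
  have h := ((hρ.submatrix fun s : (a × b × c) × (α × β × γ) => s.1).hadamard hJ).sum_blocks
  convert h using 1
  ext s t
  simp [applyLocal_apply, choiMatrix, Matrix.kroneckerMap_apply]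

/-- Cyclic relabelling of the parties `A → B → C → A` together with their sources. -/
theorem applyLocal_btnState_rotate {A₁ A₂ B₁ B₂ C₁ C₂ : Type*} [Fintype A₁] [Fintype A₂]
    [Fintype B₁] [Fintype B₂] [Fintype C₁] [Fintype C₂] [DecidableEq A₁] [DecidableEq A₂]
    [DecidableEq B₁] [DecidableEq B₂] [DecidableEq C₁] [DecidableEq C₂]
    (EA : Matrix (A₁ × A₂) (A₁ × A₂) ℂ →ₗ[ℂ] Matrix α α ℂ)
    (EB : Matrix (B₁ × B₂) (B₁ × B₂) ℂ →ₗ[ℂ] Matrix β β ℂ)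
    (EC : Matrix (C₁ × C₂) (C₁ × C₂) ℂ →ₗ[ℂ] Matrix γ γ ℂ)
    (ρb : Matrix (C₂ × A₁) (C₂ × A₁) ℂ) (ρc : Matrix (A₂ × B₁) (A₂ × B₁) ℂ)
    (ρa : Matrix (B₂ × C₁) (B₂ × C₁) ℂ) (i i' : α) (j j' : β) (k k' : γ) :
    applyLocal EB EC EA (btnState ρc ρa ρb) (j, k, i) (j', k', i') =
      applyLocal EA EB EC (btnState ρb ρc ρa) (i, j, k) (i', j', k') := by
  rw [applyLocal_apply, applyLocal_apply]
  let e : (B₁ × B₂) × (C₁ × C₂) × (A₁ × A₂) ≃ (A₁ × A₂) × (B₁ × B₂) × (C₁ × C₂) :=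
    (Equiv.prodAssoc _ _ _).symm.trans (Equiv.prodComm _ _)
  refine Fintype.sum_equiv e _ _ fun x => Fintype.sum_equiv e _ _ fun y => ?_
  simp [e, btnState, Matrix.kroneckerMap_apply]
  ring

end

/-! ### Partial traces -/

/-- The partial trace over the first tensor factor. -/
def traceFst {m n : Type*} [Fintype m] (M : Matrix (m × n) (m × n) ℂ) : Matrix n n ℂ :=
  Matrix.of fun b b' => ∑ a, M (a, b) (a, b')

/-- The partial trace over the second tensor factor. -/
def traceSnd {m n : Type*} [Fintype n] (M : Matrix (m × n) (m × n) ℂ) : Matrix m m ℂ :=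
  Matrix.of fun a a' => ∑ b, M (a, b) (a', b)

section

variable {m n : Type*} [Fintype m] [Fintype n]

theorem IsDensityMatrix.traceFst {M : Matrix (m × n) (m × n) ℂ} (hM : IsDensityMatrix M) :
    IsDensityMatrix (traceFst M) := by
  constructor
  · have h := Matrix.posSemidef_sum Finset.univ
      fun (a : m) _ => hM.1.submatrix fun b : n => (a, b)
    convert h using 1
    ext b b'
    simp [_root_.traceFst, Matrix.sum_apply]
  · rw [← hM.2]
    simp only [Matrix.trace, Matrix.diag_apply, _root_.traceFst, Matrix.of_apply,
      Fintype.sum_prod_type]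
    exact Finset.sum_comm

theorem IsDensityMatrix.traceSnd {M : Matrix (m × n) (m × n) ℂ} (hM : IsDensityMatrix M) :
    IsDensityMatrix (traceSnd M) := by
  constructor
  · have h := Matrix.posSemidef_sum Finset.univ
      fun (b : n) _ => hM.1.submatrix fun a : m => (a, b)
    convert h using 1
    ext b b'
    simp [_root_.traceSnd, Matrix.sum_apply]
  · rw [← hM.2]
    simp only [Matrix.trace, Matrix.diag_apply, _root_.traceSnd, Matrix.of_apply,
      Fintype.sum_prod_type]

theorem IsDensityMatrix.kronecker {M : Matrix m m ℂ} {N : Matrix n n ℂ}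
    (hM : IsDensityMatrix M) (hN : IsDensityMatrix N) : IsDensityMatrix (M ⊗ₖ N) :=
  ⟨hM.1.kronecker hN.1, by rw [Matrix.trace_kronecker, hM.2, hN.2, one_mul]⟩

end

theorem traceFst_kronecker {m n : Type*} [Fintype m] (M : Matrix m m ℂ)
    (N : Matrix n n ℂ) :
    traceFst (M ⊗ₖ N) = M.trace • N := by
  ext b b'
  simp [traceFst, Matrix.kroneckerMap_apply, Matrix.trace, Finset.sum_mul]

theorem traceSnd_kronecker {m n : Type*} [Fintype n] (M : Matrix m m ℂ)
    (N : Matrix n n ℂ) :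
    traceSnd (M ⊗ₖ N) = N.trace • M := by
  ext b b'
  simp [traceSnd, Matrix.kroneckerMap_apply, Matrix.trace, Finset.mul_sum, mul_comm]

theorem posSemidef_btnState {A₁ A₂ B₁ B₂ C₁ C₂ : Type*} [Finite A₁] [Finite A₂]
    [Finite B₁] [Finite B₂] [Finite C₁] [Finite C₂]
    {ρb : Matrix (C₂ × A₁) (C₂ × A₁) ℂ} {ρc : Matrix (A₂ × B₁) (A₂ × B₁) ℂ}
    {ρa : Matrix (B₂ × C₁) (B₂ × C₁) ℂ} (hb : ρb.PosSemidef) (hc : ρc.PosSemidef)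
    (ha : ρa.PosSemidef) : (btnState ρb ρc ρa).PosSemidef :=
  (hb.kronecker (hc.kronecker ha)).submatrix _

/-! ### The cut inflation -/

section

variable {A₁ A₂ B₁ B₂ C₁ C₂ α β γ : Type*} [Fintype A₁] [Fintype A₂] [Fintype B₁] [Fintype B₂]
  [Fintype C₁] [Fintype C₂] [DecidableEq A₁] [DecidableEq A₂] [DecidableEq B₁] [DecidableEq B₂]
  [DecidableEq C₁] [DecidableEq C₂]

/-- Tracing out the output of the third party discards its channel, and only the marginals of the
two sources feeding that party remain. -/
theorem sum_applyLocal_btnState_third [Fintype γ]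
    (EA : Matrix (A₁ × A₂) (A₁ × A₂) ℂ →ₗ[ℂ] Matrix α α ℂ)
    (EB : Matrix (B₁ × B₂) (B₁ × B₂) ℂ →ₗ[ℂ] Matrix β β ℂ)
    {EC : Matrix (C₁ × C₂) (C₁ × C₂) ℂ →ₗ[ℂ] Matrix γ γ ℂ}
    (hC : ∀ X, (EC X).trace = X.trace)
    (ρb : Matrix (C₂ × A₁) (C₂ × A₁) ℂ) (ρc : Matrix (A₂ × B₁) (A₂ × B₁) ℂ)
    (ρa : Matrix (B₂ × C₁) (B₂ × C₁) ℂ) (i i' : α) (j j' : β) :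
    ∑ k, applyLocal EA EB EC (btnState ρb ρc ρa) (i, j, k) (i', j', k) =
      ∑ a, ∑ b, ∑ a', ∑ b', traceFst ρb a.1 a'.1 * ρc (a.2, b.1) (a'.2, b'.1) *
        traceSnd ρa b.2 b'.2 *
          (EA (Matrix.single a a' 1) i i' * EB (Matrix.single b b' 1) j j') := by
  have htr : ∀ c c' : C₁ × C₂, ∑ k, EC (Matrix.single c c' 1) k k = if c = c' then 1 else 0 := by
    intro c c'
    have h := hC (Matrix.single c c' 1)
    rw [Matrix.trace] at h
    simp only [Matrix.diag_apply] at h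
    rw [h]
    split_ifs with hcc
    · subst hcc; simp
    · exact Matrix.trace_single_eq_of_ne _ _ _ hcc
  have hsum : ∑ k, applyLocal EA EB EC (btnState ρb ρc ρa) (i, j, k) (i', j', k) =
      ∑ x, ∑ y, btnState ρb ρc ρa x y * (EA (Matrix.single x.1 y.1 1) i i' *
        (EB (Matrix.single x.2.1 y.2.1 1) j j' * if x.2.2 = y.2.2 then 1 else 0)) := by
    simp only [applyLocal_apply, ← htr, Finset.mul_sum]
    rw [Finset.sum_comm]
    exact Finset.sum_congr rfl fun x _ => Finset.sum_comm
  have hprod (f : (A₁ × A₂) × (B₁ × B₂) × (C₁ × C₂) → ℂ) :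
      ∑ y, f y = ∑ a, ∑ b, ∑ c, f (a, b, c) :=
    (Fintype.sum_prod_type f).trans (Finset.sum_congr rfl fun _ _ => Fintype.sum_prod_type _)
  simp only [hsum, hprod]
  refine Finset.sum_congr rfl fun a _ => Finset.sum_congr rfl fun b _ => ?_
  rw [Finset.sum_comm]
  refine Finset.sum_congr rfl fun a' _ => ?_
  rw [Finset.sum_comm]
  refine Finset.sum_congr rfl fun b' _ => ?_
  simp only [mul_ite, mul_one, mul_zero, Finset.sum_ite_eq, Finset.mem_univ, if_true]
  rw [Fintype.sum_prod_type]
  simp only [traceFst, traceSnd, Matrix.of_apply, Finset.sum_mul, Finset.mul_sum]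
  refine Finset.sum_congr rfl fun c₁ _ => Finset.sum_congr rfl fun c₂ _ => ?_
  simp only [btnState, Matrix.submatrix_apply, Matrix.kroneckerMap_apply]
  ring

/-- Without shared source between the first and the third party, their joint reduced state is a
product. -/
theorem sum_applyLocal_btnState_kronecker [Fintype β]
    (EA : Matrix (A₁ × A₂) (A₁ × A₂) ℂ →ₗ[ℂ] Matrix α α ℂ)
    {EB : Matrix (B₁ × B₂) (B₁ × B₂) ℂ →ₗ[ℂ] Matrix β β ℂ}
    (hB : ∀ X, (EB X).trace = X.trace)
    (EC : Matrix (C₁ × C₂) (C₁ × C₂) ℂ →ₗ[ℂ] Matrix γ γ ℂ)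
    (τ : Matrix C₂ C₂ ℂ) (σ : Matrix A₁ A₁ ℂ) (ρc : Matrix (A₂ × B₁) (A₂ × B₁) ℂ)
    (ρa : Matrix (B₂ × C₁) (B₂ × C₁) ℂ) (i i' : α) (k k' : γ) :
    ∑ j, applyLocal EA EB EC (btnState (τ ⊗ₖ σ) ρc ρa) (i, j, k) (i', j, k') =
      EA (σ ⊗ₖ traceSnd ρc) i i' * EC (traceFst ρa ⊗ₖ τ) k k' := by
  simp_rw [← applyLocal_btnState_rotate EA EB EC, ← applyLocal_btnState_rotate EB EC EA]
  rw [sum_applyLocal_btnState_third EC EA hB, linearMap_apply_eq_sum_single EA,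
    linearMap_apply_eq_sum_single EC, Finset.sum_comm, Finset.sum_mul_sum]
  refine Finset.sum_congr rfl fun a _ => ?_
  refine Finset.sum_congr rfl fun c _ => ?_
  rw [Finset.sum_mul_sum, Finset.sum_comm]
  refine Finset.sum_congr rfl fun a' _ => Finset.sum_congr rfl fun c' _ => ?_
  simp only [Matrix.kroneckerMap_apply]
  ring

/-- The outcome distribution `p` of a triangle network has a cut inflation `q`: replacing the source
shared by the first and the third party by the product of its marginals keeps the two pair
marginals that involve the second party, and makes the outcomes of the other two parties
independent. -/
theorem exists_cut_inflation [Fintype α] [Fintype β] [Fintype γ]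
    {EA : Matrix (A₁ × A₂) (A₁ × A₂) ℂ →ₗ[ℂ] Matrix α α ℂ}
    {EB : Matrix (B₁ × B₂) (B₁ × B₂) ℂ →ₗ[ℂ] Matrix β β ℂ}
    {EC : Matrix (C₁ × C₂) (C₁ × C₂) ℂ →ₗ[ℂ] Matrix γ γ ℂ}
    (hA : IsQuantumChannel EA) (hB : IsQuantumChannel EB) (hC : IsQuantumChannel EC)
    {ρb : Matrix (C₂ × A₁) (C₂ × A₁) ℂ} {ρc : Matrix (A₂ × B₁) (A₂ × B₁) ℂ}
    {ρa : Matrix (B₂ × C₁) (B₂ × C₁) ℂ} (hb : IsDensityMatrix ρb) (hc : IsDensityMatrix ρc)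
    (ha : IsDensityMatrix ρa) {p : α → β → γ → ℝ}
    (hp : ∀ i j k, applyLocal EA EB EC (btnState ρb ρc ρa) (i, j, k) (i, j, k) = p i j k) :
    ∃ q : α → β → γ → ℝ, (∀ i j k, 0 ≤ q i j k) ∧
      (∀ i j, ∑ k, q i j k = ∑ k, p i j k) ∧ (∀ j k, ∑ i, q i j k = ∑ i, p i j k) ∧
      (∑ i, ∑ j, ∑ k, p i j k = 1) ∧
      ∀ i k, ∑ j, q i j k = (∑ j, ∑ k', p i j k') * ∑ j, ∑ i', p i' j k := by
  set τ := traceSnd ρb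
  set σ := traceFst ρb
  have hτ' : IsDensityMatrix τ := hb.traceSnd
  have hσ' : IsDensityMatrix σ := hb.traceFst
  have hF : traceFst (τ ⊗ₖ σ) = traceFst ρb := by rw [traceFst_kronecker, hτ'.2, one_smul]
  have hS : traceSnd (τ ⊗ₖ σ) = traceSnd ρb := by rw [traceSnd_kronecker, hσ'.2, one_smul]
  have hpos := posSemidef_applyLocal hA.1 hB.1 hC.1
    (posSemidef_btnState (hτ'.kronecker hσ').1 hc.1 ha.1)
  let q : α → β → γ → ℝ := fun i j k =>
    (applyLocal EA EB EC (btnState (τ ⊗ₖ σ) ρc ρa) (i, j, k) (i, j, k)).re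
  have hq : ∀ i j k,
      applyLocal EA EB EC (btnState (τ ⊗ₖ σ) ρc ρa) (i, j, k) (i, j, k) = q i j k := fun i j k =>
    Complex.ext rfl
      (by simpa using (Complex.nonneg_iff.1 (hpos.diag_nonneg (i := (i, j, k)))).2.symm)
  have hAB : ∀ i j, ∑ k, q i j k = ∑ k, p i j k := by
    intro i j
    have h := sum_applyLocal_btnState_third EA EB hC.2 (τ ⊗ₖ σ) ρc ρa i i j j
    rw [hF, ← sum_applyLocal_btnState_third EA EB hC.2 ρb ρc ρa i i j j] at h
    simp only [hp, hq] at h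
    exact_mod_cast h
  have hBC : ∀ j k, ∑ i, q i j k = ∑ i, p i j k := by
    intro j k
    have h := sum_applyLocal_btnState_third EB EC hA.2 ρc ρa (τ ⊗ₖ σ) j j k k
    rw [hS, ← sum_applyLocal_btnState_third EB EC hA.2 ρc ρa ρb j j k k] at h
    simp only [applyLocal_btnState_rotate, hp, hq] at h
    exact_mod_cast h
  -- The two factors of the product marginal are the two single-party marginals, as each of
  -- them sums to one.
  let x : α → ℂ := fun i => EA (σ ⊗ₖ traceSnd ρc) i i
  let y : γ → ℂ := fun k => EC (traceFst ρa ⊗ₖ τ) k k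
  have hx : ∑ i, x i = 1 := (hA.2 _).trans (hσ'.kronecker hc.traceSnd).2
  have hy : ∑ k, y k = 1 := (hC.2 _).trans (ha.traceFst.kronecker hτ').2
  have hxy : ∀ i k, ∑ j, (q i j k : ℂ) = x i * y k := by
    intro i k
    have h := sum_applyLocal_btnState_kronecker EA hB.2 EC τ σ ρc ρa i i k k
    simpa only [hq] using h
  have hxp : ∀ i, x i = ((∑ j, ∑ k, p i j k : ℝ) : ℂ) := by
    intro i
    simp_rw [← hAB]
    rw [Finset.sum_comm]
    push_cast
    simp_rw [hxy]
    rw [← Finset.mul_sum, hy, mul_one]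
  have hyp : ∀ k, y k = ((∑ j, ∑ i, p i j k : ℝ) : ℂ) := by
    intro k
    simp_rw [← hBC]
    rw [Finset.sum_comm]
    push_cast
    simp_rw [hxy]
    rw [← Finset.sum_mul, hx, one_mul]
  refine ⟨q, fun i j k => (Complex.nonneg_iff.1 hpos.diag_nonneg).1, hAB, hBC, ?_, fun i k => ?_⟩
  · simp_rw [hxp] at hx
    exact_mod_cast hx
  · have h := hxy i k
    rw [hxp, hyp] at h
    exact_mod_cast h

/-- Disagreement between the outer parties of the cut inflation forces a disagreement between
neighbours, which bounds the disagreement of two independent outer parties. -/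
theorem cut_inflation_inequality
    {EA : Matrix (A₁ × A₂) (A₁ × A₂) ℂ →ₗ[ℂ] Matrix (Fin 2) (Fin 2) ℂ}
    {EB : Matrix (B₁ × B₂) (B₁ × B₂) ℂ →ₗ[ℂ] Matrix (Fin 2) (Fin 2) ℂ}
    {EC : Matrix (C₁ × C₂) (C₁ × C₂) ℂ →ₗ[ℂ] Matrix (Fin 2) (Fin 2) ℂ}
    (hA : IsQuantumChannel EA) (hB : IsQuantumChannel EB) (hC : IsQuantumChannel EC)
    {ρb : Matrix (C₂ × A₁) (C₂ × A₁) ℂ} {ρc : Matrix (A₂ × B₁) (A₂ × B₁) ℂ}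
    {ρa : Matrix (B₂ × C₁) (B₂ × C₁) ℂ} (hb : IsDensityMatrix ρb) (hc : IsDensityMatrix ρc)
    (ha : IsDensityMatrix ρa) {p : Fin 2 → Fin 2 → Fin 2 → ℝ}
    (hp : ∀ i j k, applyLocal EA EB EC (btnState ρb ρc ρa) (i, j, k) (i, j, k) = p i j k) :
    (∑ j, ∑ k, p 0 j k) * (∑ i, ∑ j, p i j 1) + (∑ j, ∑ k, p 1 j k) * (∑ i, ∑ j, p i j 0) ≤
      ∑ k, (p 0 1 k + p 1 0 k) + ∑ i, (p i 0 1 + p i 1 0) := by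
  obtain ⟨q, hq, hAB, hBC, -, hAC⟩ := exists_cut_inflation hA hB hC hb hc ha hp
  rw [Finset.sum_comm (f := fun i j => p i j 1), Finset.sum_comm (f := fun i j => p i j 0),
    ← hAC, ← hAC]
  simp only [Finset.sum_add_distrib, ← hAB, ← hBC, Fin.sum_univ_two]
  linarith [hq 0 1 0, hq 0 0 1, hq 1 0 1, hq 1 1 0, hq 0 1 1, hq 1 0 0]

end

/-! ### The fidelity bound -/

/-- Fidelity bound for weights `P`, `Q` of the outcomes `000`, `111`, total weights `u`, `v` of the
outcomes with a single one and with a single zero, and probabilities `a`, `b`, `c` of the outcome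
one for the three parties. The hypothesis `h` is the sum of the three cut inequalities. -/
theorem half_add_lt_of_sum_disagreement_le {P Q u v a b c t : ℝ} (hP : 0 ≤ P) (hQ : 0 ≤ Q)
    (hu : 0 ≤ u) (hv : 0 ≤ v) (hsum : P + Q + u + v = 1)
    (habc : a + b + c = 3 * Q + u + 2 * v) (ht : t ^ 2 ≤ P * Q)
    (h : 2 * (a + b + c) - 2 * (a * b + b * c + c * a) ≤ 4 * (u + v)) :
    (P + Q) / 2 + t < 7 / 10 := by
  -- The mean `(a + b + c) / 3` may replace each of `a`, `b`, `c`.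
  have hmean : 3 * (a * b + b * c + c * a) ≤ (a + b + c) ^ 2 := by
    linarith [sq_nonneg (a - b), sq_nonneg (b - c), sq_nonneg (c - a)]
  have hx : 6 * ((Q + (u + 2 * v) / 3) * (P + (2 * u + v) / 3)) ≤ 4 * (u + v) := by
    have h1 : Q + (u + 2 * v) / 3 = (a + b + c) / 3 := by linarith
    have h2 : P + (2 * u + v) / 3 = 1 - (a + b + c) / 3 := by linarith
    rw [h1, h2]
    linarith
  obtain ⟨r, hr⟩ : ∃ r, r = u + v := ⟨_, rfl⟩
  have hr0 : 0 ≤ r := by linarith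
  have hs : P + Q = 1 - r := by linarith
  have hlow : (Q + r / 3) * (P + r / 3) ≤ (Q + (u + 2 * v) / 3) * (P + (2 * u + v) / 3) := by
    apply mul_le_mul <;> linarith
  have hPQ : P * Q ≤ r / 3 + 2 * r ^ 2 / 9 := by
    have he : (Q + r / 3) * (P + r / 3) = P * Q + r / 3 * (P + Q) + r ^ 2 / 9 := by ring
    rw [he, hs] at hlow
    linarith
  by_contra! hF
  have ht' : t ≤ (P + Q) / 2 :=
    abs_le_of_sq_le_sq' (by linarith [sq_nonneg (P - Q)]) (by linarith) |>.2
  -- Now `r ≤ 3 / 10`, while `(1 / 5 + r / 2) ^ 2 ≤ t ^ 2 ≤ r / 3 + 2 * r ^ 2 / 9` fails there.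
  have hr3 : r ≤ 3 / 10 := by linarith
  have hsq : (1 / 5 + r / 2) ^ 2 ≤ t ^ 2 := by
    have : 1 / 5 + r / 2 ≤ t := by linarith
    gcongr
  linarith [sq_nonneg (r - 3 / 10)]

/-- Fidelity bound from the three cut inequalities `hA`, `hB`, `hC`, labelled by the middle party;
`p i j k` are the outcome probabilities and `t` is the coherence between `000` and `111`. -/
theorem half_add_lt_of_cut_inequalities {p : Fin 2 → Fin 2 → Fin 2 → ℝ} {t : ℝ}
    (hp : ∀ i j k, 0 ≤ p i j k) (hsum : ∑ i, ∑ j, ∑ k, p i j k = 1)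
    (ht : t ^ 2 ≤ p 0 0 0 * p 1 1 1)
    (hB : (∑ j, ∑ k, p 0 j k) * (∑ i, ∑ j, p i j 1) +
        (∑ j, ∑ k, p 1 j k) * (∑ i, ∑ j, p i j 0) ≤
      ∑ k, (p 0 1 k + p 1 0 k) + ∑ i, (p i 0 1 + p i 1 0))
    (hC : (∑ k, ∑ i, p i 0 k) * (∑ j, ∑ k, p 1 j k) +
        (∑ k, ∑ i, p i 1 k) * (∑ j, ∑ k, p 0 j k) ≤
      ∑ i, (p i 0 1 + p i 1 0) + ∑ j, (p 1 j 0 + p 0 j 1))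
    (hA : (∑ i, ∑ j, p i j 0) * (∑ k, ∑ i, p i 1 k) +
        (∑ i, ∑ j, p i j 1) * (∑ k, ∑ i, p i 0 k) ≤
      ∑ j, (p 1 j 0 + p 0 j 1) + ∑ k, (p 0 1 k + p 1 0 k)) :
    (p 0 0 0 + p 1 1 1) / 2 + t < 7 / 10 := by
  obtain ⟨a, ha⟩ : ∃ a, a = ∑ j, ∑ k, p 1 j k := ⟨_, rfl⟩
  obtain ⟨b, hb⟩ : ∃ b, b = ∑ k, ∑ i, p i 1 k := ⟨_, rfl⟩
  obtain ⟨c, hc⟩ : ∃ c, c = ∑ i, ∑ j, p i j 1 := ⟨_, rfl⟩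
  have ha' : ∑ j, ∑ k, p 0 j k = 1 - a := by
    simp only [Fin.sum_univ_two] at ha hsum ⊢; linarith
  have hb' : ∑ k, ∑ i, p i 0 k = 1 - b := by
    simp only [Fin.sum_univ_two] at hb hsum ⊢; linarith
  have hc' : ∑ i, ∑ j, p i j 0 = 1 - c := by
    simp only [Fin.sum_univ_two] at hc hsum ⊢; linarith
  rw [ha', hc', ← ha, ← hc] at hB
  rw [hb', ha', ← ha, ← hb] at hC
  rw [hc', hb', ← hb, ← hc] at hA
  simp only [Fin.sum_univ_two] at hA hB hC ha hb hc hsum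
  refine half_add_lt_of_sum_disagreement_le (u := p 0 0 1 + p 0 1 0 + p 1 0 0)
    (v := p 0 1 1 + p 1 0 1 + p 1 1 0) (a := a) (b := b) (c := c) (hp 0 0 0) (hp 1 1 1) ?_ ?_ ?_ ?_
    ht ?_
  · linarith [hp 0 0 1, hp 0 1 0, hp 1 0 0]
  · linarith [hp 0 1 1, hp 1 0 1, hp 1 1 0]
  · linarith
  · linarith
  · linarith

theorem pureFidelity_ghz (ρ : Matrix (Fin 2 × Fin 2 × Fin 2) (Fin 2 × Fin 2 × Fin 2) ℂ) :
    pureFidelity ghz ρ = ((ρ (0, 0, 0) (0, 0, 0) + ρ (0, 0, 0) (1, 1, 1) +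
      ρ (1, 1, 1) (0, 0, 0) + ρ (1, 1, 1) (1, 1, 1)) / 2).re := by
  have h2 : ((1 / √2 : ℝ) : ℂ) * ((1 / √2 : ℝ) : ℂ) = 1 / 2 := by
    rw [← Complex.ofReal_mul, div_mul_div_comm, Real.mul_self_sqrt (by norm_num)]
    norm_num
  have hstar : star ghz = ghz := by
    rw [ghz, star_smul, star_add]
    simp [Complex.conj_ofReal]
  rw [pureFidelity, hstar, ghz, Matrix.mulVec_smul, smul_dotProduct, dotProduct_smul, smul_smul,
    h2]
  congr 1
  simp [Matrix.mulVec_add, add_dotProduct, dotProduct_add]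
  ring

/-- Positivity bounds the coherence between `000` and `111` by the geometric mean of their weights,
and the cut inequalities for the three choices of the middle party bound the latter. -/
theorem IsCTNState.pureFidelity_ghz_lt
    {ρ : Matrix (Fin 2 × Fin 2 × Fin 2) (Fin 2 × Fin 2 × Fin 2) ℂ} (h : IsCTNState ρ) :
    pureFidelity ghz ρ < 7 / 10 := by
  obtain ⟨a₁, a₂, b₁, b₂, c₁, c₂, ρb, ρc, ρa, EA, EB, EC, hb, hc, ha, hA, hB, hC, rfl⟩ := h
  have hpos := posSemidef_applyLocal hA.1 hB.1 hC.1 (posSemidef_btnState hb.1 hc.1 ha.1)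
  set ρ := applyLocal EA EB EC (btnState ρb ρc ρa) with hρ
  let p : Fin 2 → Fin 2 → Fin 2 → ℝ := fun i j k => (ρ (i, j, k) (i, j, k)).re
  have hp : ∀ i j k, ρ (i, j, k) (i, j, k) = p i j k := fun i j k =>
    Complex.ext rfl
      (by simpa using (Complex.nonneg_iff.1 (hpos.diag_nonneg (i := (i, j, k)))).2.symm)
  have hherm : ρ (1, 1, 1) (0, 0, 0) = star (ρ (0, 0, 0) (1, 1, 1)) :=
    (hpos.1.apply _ _).symm
  have hdet : (ρ (0, 0, 0) (1, 1, 1)).re ^ 2 ≤ p 0 0 0 * p 1 1 1 := by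
    have h := (hpos.submatrix ![(0, 0, 0), (1, 1, 1)]).det_nonneg
    rw [Matrix.det_fin_two] at h
    simp only [Matrix.submatrix_apply, Matrix.cons_val_zero, Matrix.cons_val_one, hp, hherm] at h
    have h' := (Complex.nonneg_iff.1 h).1
    simp at h'
    nlinarith [sq_nonneg (ρ (0, 0, 0) (1, 1, 1)).im]
  have hF : pureFidelity ghz ρ = (p 0 0 0 + p 1 1 1) / 2 + (ρ (0, 0, 0) (1, 1, 1)).re := by
    rw [pureFidelity_ghz, hp, hp, hherm]
    simp
    ring
  rw [hF]
  obtain ⟨-, -, -, -, hsum, -⟩ := exists_cut_inflation hA hB hC hb hc ha hp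
  refine half_add_lt_of_cut_inequalities
    (fun i j k => (Complex.nonneg_iff.1 hpos.diag_nonneg).1) hsum hdet
    (cut_inflation_inequality hA hB hC hb hc ha hp)
    (cut_inflation_inequality (p := fun j k i => p i j k) hB hC hA hc ha hb fun j k i => ?_)
    (cut_inflation_inequality (p := fun k i j => p i j k) hC hA hB ha hb hc fun k i j => ?_)
  · rw [applyLocal_btnState_rotate, ← hρ, hp]
  · rw [applyLocal_btnState_rotate, applyLocal_btnState_rotate, ← hρ, hp]

/-- The fidelity is a continuous linear function of the state, so a bound on the states of the
triangle network with local channels passes to mixtures. -/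
theorem IsLOSRState.pureFidelity_le {α β γ : Type*} [Fintype α] [Fintype β] [Fintype γ]
    {ψ : α × β × γ → ℂ} {C : ℝ}
    (hC : ∀ σ : Matrix (α × β × γ) (α × β × γ) ℂ, IsCTNState σ → pureFidelity ψ σ ≤ C)
    {ρ : Matrix (α × β × γ) (α × β × γ) ℂ} (h : IsLOSRState ρ) : pureFidelity ψ ρ ≤ C := by
  obtain ⟨L, p, σ, hp, hsum, hσ, hρ⟩ := h
  let F : Matrix (α × β × γ) (α × β × γ) ℂ →ₗ[ℝ] ℝ :=
    { toFun := pureFidelity ψ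
      map_add' := fun M N => by simp [pureFidelity, Matrix.add_mulVec, dotProduct_add]
      map_smul' := fun c M => by simp [pureFidelity, Matrix.smul_mulVec, dotProduct_smul] }
  have hcont : Continuous F := by
    change Continuous fun M : Matrix (α × β × γ) (α × β × γ) ℂ => (star ψ ⬝ᵥ (M *ᵥ ψ)).re
    fun_prop
  have hF := hρ.map F hcont
  have hle := hasSum_le (fun l => ?_) hF (hsum.mul_right C)
  · rwa [one_mul] at hle
  · rw [Function.comp_apply, map_smul, smul_eq_mul]
    exact mul_le_mul_of_nonneg_left (hC _ (hσ l)) (hp l)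

theorem mainTheorem9 :
    (∀ ρ : Matrix (Fin 2 × Fin 2 × Fin 2) (Fin 2 × Fin 2 × Fin 2) ℂ, IsCTNState ρ →
      pureFidelity ghz ρ ≤ 3 - √5 ∧ pureFidelity ghz ρ ≤ 1 / √2) ∧
    (∀ ρ : Matrix (Fin 2 × Fin 2 × Fin 2) (Fin 2 × Fin 2 × Fin 2) ℂ, IsLOSRState ρ →
      pureFidelity ghz ρ ≤ 3 - √5 ∧ pureFidelity ghz ρ ≤ 1 / √2) := by
  have h5 : (7 / 10 : ℝ) ≤ 3 - √5 := by
    have : √5 ≤ 23 / 10 := Real.sqrt_le_iff.2 ⟨by norm_num, by norm_num⟩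
    linarith
  have h2 : (7 / 10 : ℝ) ≤ 1 / √2 := by
    have : √2 ≤ 10 / 7 := Real.sqrt_le_iff.2 ⟨by norm_num, by norm_num⟩
    rw [le_div_iff₀ (by positivity)]
    linarith
  have hCTN : ∀ ρ : Matrix (Fin 2 × Fin 2 × Fin 2) (Fin 2 × Fin 2 × Fin 2) ℂ, IsCTNState ρ →
      pureFidelity ghz ρ ≤ 7 / 10 := fun ρ hρ => hρ.pureFidelity_ghz_lt.le
  exact ⟨fun ρ hρ => ⟨(hCTN ρ hρ).trans h5, (hCTN ρ hρ).trans h2⟩,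
    fun ρ hρ => ⟨(hρ.pureFidelity_le hCTN).trans h5, (hρ.pureFidelity_le hCTN).trans h2⟩⟩
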